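/- For real parameters $\eta,\theta$ with $1+\eta\theta\ge 0$, for $0\le s<t$ and $x\in\mathbb R$, let $Q_n(y)=Q_n(y;x,t,s)$ be the monic polynomials in $y$ given by $Q_0=1$, $Q_1=y-x$, $$yQ_1=Q_2+\big((t-s)\eta+\theta\big)Q_1+(t-s)(1+x\eta)Q_0,$$ $$yQ_n=Q_{n+1}+(t\eta+\theta)Q_n+t(1+\eta\theta)Q_{n-1}\qquad(n\ge 2).$$ If $1+x\eta\ge 0$, let $P_{s,t}(x,dy)$ be the unique probability measure on $\mathbb R$ with finite moments that makes the polynomials $(Q_n)_{n\ge0}$ pairwise orthogonal. The (free) bi-Poisson process with parameters $\eta,\theta$ is the real-valued Markov process $(X_t)_{t\ge0}$ with $X_0=0$ almost surely and transition probabilities $P_{s,t}(x,dy)$, that is, $P(X_t\in B\mid X_r,\ 0\le r\le s)=P_{s,t}(X_s,B)$ almost surely for all $0\le s<t$ and all Borel sets $B\subseteq\mathbb R$. (For each $s \geq 0$ one has $1+\eta X_s\ge 0$ almost surely.) **Corollary.** Let $(X_t)_{t\ge 0}$ be a bi-Poisson process with parameters $\eta=\theta\in\mathbb R$ (so that $1+\eta\theta\ge0$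 holds automatically). Then the time-inverted process $(tX_{1/t})_{t>0}$ has the same finite-dimensional distributions as $(X_t)_{t>0}$. -/

import Mathlib

open MeasureTheory ProbabilityTheory
open scoped NNReal ENNReal

namespace BiPoisson

/-- The monic polynomials `Q_n(y; x, t, s)` in the variable `y`, given by
`Q_0 = 1`, `Q_1 = y - x`,
`y Q_1 = Q_2 + ((t - s) η + θ) Q_1 + (t - s) (1 + x η) Q_0`, and
`y Q_n = Q_{n+1} + (t η + θ) Q_n + t (1 + η θ) Q_{n-1}` for `n ≥ 2`. -/
noncomputable def transPoly (η θ s t x : ℝ) : ℕ → Polynomial ℝ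
  | 0 => 1
  | 1 => Polynomial.X - Polynomial.C x
  | 2 => (Polynomial.X - Polynomial.C ((t - s) * η + θ)) * (Polynomial.X - Polynomial.C x)
          - Polynomial.C ((t - s) * (1 + x * η))
  | n + 3 => (Polynomial.X - Polynomial.C (t * η + θ)) * transPoly η θ s t x (n + 2)
          - Polynomial.C (t * (1 + η * θ)) * transPoly η θ s t x (n + 1)

/-- `μ` is a probability measure with finite moments with respect to which the polynomials
`Q 0, Q 1, …` are pairwise orthogonal. -/
def IsOrthogonalityMeasure (Q : ℕ → Polynomial ℝ) (μ : Measure ℝ) : Prop :=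
  IsProbabilityMeasure μ ∧ (∀ n : ℕ, Integrable (fun y : ℝ => y ^ n) μ) ∧
    ∀ m n : ℕ, m ≠ n → ∫ y, (Q m).eval y * (Q n).eval y ∂μ = 0

open Classical in
/-- The transition probability `P_{s,t}(x, dy)`: the (unique) probability measure making the
polynomials `Q_n(y; x, t, s)` orthogonal. It exists for `0 ≤ s < t`, `1 + η θ ≥ 0` and
`1 + x η ≥ 0`; where there is no such measure the value is the zero measure. -/
noncomputable def transition (η θ : ℝ) (s t : ℝ≥0) (x : ℝ) : Measure ℝ :=
  if h : ∃ μ : Measure ℝ, IsOrthogonalityMeasure (transPoly η θ s t x) μ then h.choose else 0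

/-- The `σ`-field `F_s` generated by the random variables `X_r`, `0 ≤ r ≤ s`. -/
abbrev past {Ω : Type*} (X : ℝ≥0 → Ω → ℝ) (s : ℝ≥0) : MeasurableSpace Ω :=
  ⨆ r : ℝ≥0, ⨆ _ : r ≤ s, MeasurableSpace.comap (X r) (borel ℝ)

/-- `(X_t)_{t ≥ 0}` is a (free) bi-Poisson process with parameters `η, θ`: the Markov process
started at `0` with transition probabilities `P_{s,t}(x, dy)`, that is,
`P(X_t ∈ B | F_s) = P_{s,t}(X_s, B)` almost surely for all `0 ≤ s < t` and all Borel sets `B`. -/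
structure IsBiPoissonProcess {Ω : Type*} [MeasurableSpace Ω] (η θ : ℝ)
    (X : ℝ≥0 → Ω → ℝ) (P : Measure Ω) : Prop where
  measurable : ∀ t, Measurable (X t)
  initial : ∀ᵐ ω ∂P, X 0 ω = 0
  markov : ∀ s t : ℝ≥0, s < t → ∀ B : Set ℝ, MeasurableSet B →
    P[(X t ⁻¹' B).indicator (fun _ => (1 : ℝ)) | past X s]
      =ᵐ[P] fun ω => (transition η θ s t (X s ω)).real B

end BiPoisson

/-!
The moments of the process at positive times form a functional on polynomials in the variables
`X_t`, and the transition probabilities act on polynomials in `y` through operators that send the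
orthogonal polynomials `p_n(y; t)` of the law of `X_t` to those at the earlier time `s`. This
functional is determined by two properties: the `p_n(y; t)` are orthogonal at each time `t`, and the
Markov property holds with these operators.

Time inversion preserves both properties up to exchanging `η` and `θ`. For orthogonality this is
`p_n(t y; t) = t ^ n p_n(y; 1 / t)`, with exchanged parameters on the right. The Markov property has
to be reversed in time: by the norms `t ^ n (1 + η θ) ^ (n - 1)` of the polynomials, the operator
from `s` to `t` is adjoint to the one from `1 / t` to `1 / s`.

Laws of bounded vectors are determined by their moments, and `X_t` is bounded because the
coefficients of its three-term recurrence are.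
-/

namespace BiPoisson

open Polynomial

section ThreeTermRecurrence

variable {R : Type*} [CommRing R] {p : ℕ → R[X]} {a b : ℕ → R}

/-- `p 0 = 1, p 1, p 2, …` satisfy the three-term recurrence
`X * p n = p (n + 1) + a n * p n + b n * p (n - 1)` of a sequence of monic orthogonal polynomials
with diagonal Jacobi parameters `a` and off-diagonal ones `b`. Truncated subtraction turns
`p (0 - 1)` into `p 0`, so `b 0` should be `0` for `a 0` to have its usual meaning. -/
structure HasJacobiParameters (p : ℕ → R[X]) (a b : ℕ → R) : Prop where
  zero : p 0 = 1
  X_mul : ∀ n, X * p n = p (n + 1) + C (a n) * p n + C (b n) * p (n - 1)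

namespace HasJacobiParameters

theorem succ_eq (h : HasJacobiParameters p a b) (n : ℕ) :
    p (n + 1) = (X - C (a n)) * p n - C (b n) * p (n - 1) := by
  linear_combination -h.X_mul n

theorem isMonicOfDegree [Nontrivial R] (h : HasJacobiParameters p a b) (n : ℕ) :
    IsMonicOfDegree (p n) n := by
  induction n using Nat.strong_induction_on with
  | _ n ih =>
    rcases n with _ | n
    · simp [h.zero]
    · rw [h.succ_eq, Nat.add_comm]
      refine ((isMonicOfDegree_X_sub_one (a n)).mul (ih n n.lt_succ_self)).sub ?_
      calc (C (b n) * p (n - 1)).natDegree ≤ (p (n - 1)).natDegree := natDegree_C_mul_le _ _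
        _ = n - 1 := (ih _ (by omega)).natDegree_eq
        _ < 1 + n := by omega

/-- The monic polynomials `p n`, which have degree `n`, as a basis of `R[X]`. -/
noncomputable def basis [IsDomain R] (h : HasJacobiParameters p a b) : Module.Basis ℕ R R[X] :=
  Polynomial.Sequence.basis
    ⟨p, fun n => (degree_eq_iff_natDegree_eq (h.isMonicOfDegree n).ne_zero).2
      (h.isMonicOfDegree n).natDegree_eq⟩
    fun n => (h.isMonicOfDegree n).leadingCoeff_eq ▸ isUnit_one

@[simp]
theorem basis_apply [IsDomain R] (h : HasJacobiParameters p a b) (n : ℕ) : h.basis n = p n :=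
  Polynomial.Sequence.basis_eq_self _ _ n

theorem map_mul_self (h : HasJacobiParameters p a b) {L : R[X] →ₗ[R] R}
    (hL : Pairwise fun m n => L (p m * p n) = 0) (n : ℕ) :
    L (p n * p n) = (∏ i ∈ Finset.range n, b (i + 1)) * L 1 := by
  induction n with
  | zero => simp [h.zero]
  | succ n ih =>
    -- `X` is symmetric: both sides expand `X * p n * p (n + 1)`
    have expand : p (n + 1) * p (n + 1) + a n • (p n * p (n + 1)) + b n • (p (n - 1) * p (n + 1))
        = p (n + 2) * p n + a (n + 1) • (p (n + 1) * p n) + b (n + 1) • (p n * p n) := by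
      have X_mul_succ := h.X_mul (n + 1)
      rw [Nat.add_sub_cancel] at X_mul_succ
      simp only [smul_eq_C_mul]
      linear_combination p n * X_mul_succ - p (n + 1) * h.X_mul n
    simpa only [map_add, map_smul, smul_eq_mul, hL n.lt_succ_self.ne, hL n.lt_succ_self.ne',
      hL (show n - 1 ≠ n + 1 by omega), hL (show n + 2 ≠ n by omega), ih, mul_zero, add_zero,
      zero_add, Finset.prod_range_succ, mul_left_comm, mul_assoc] using congrArg L expand

theorem abs_map_X_pow_mul_le {p : ℕ → ℝ[X]} {a b : ℕ → ℝ} (h : HasJacobiParameters p a b)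
    {L : ℝ[X] →ₗ[ℝ] ℝ} (hL : ∀ n, L (p (n + 1)) = 0) {A B : ℝ} (ha : ∀ n, |a n| ≤ A)
    (hb : ∀ n, |b n| ≤ B) (n k : ℕ) : |L (X ^ n * p k)| ≤ |L 1| * (1 + A + B) ^ n := by
  have hA : 0 ≤ A := (abs_nonneg _).trans (ha 0)
  have hB : 0 ≤ B := (abs_nonneg _).trans (hb 0)
  induction n generalizing k with
  | zero => rcases k with _ | k <;> simp [h.zero, hL]
  | succ n ih =>
    have expand : X ^ (n + 1) * p k
        = X ^ n * p (k + 1) + a k • (X ^ n * p k) + b k • (X ^ n * p (k - 1)) := by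
      simp only [smul_eq_C_mul]
      linear_combination X ^ n * h.X_mul k
    calc |L (X ^ (n + 1) * p k)|
        ≤ |L (X ^ n * p (k + 1))| + |a k| * |L (X ^ n * p k)|
            + |b k| * |L (X ^ n * p (k - 1))| := by
          rw [expand, map_add, map_add, map_smul, map_smul, smul_eq_mul, smul_eq_mul, ← abs_mul,
            ← abs_mul]
          exact abs_add_three _ _ _
      _ ≤ |L 1| * (1 + A + B) ^ n + A * (|L 1| * (1 + A + B) ^ n)
            + B * (|L 1| * (1 + A + B) ^ n) := by
          gcongr
          exacts [ih _, ha k, ih _, hb k, ih _]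
      _ = |L 1| * (1 + A + B) ^ (n + 1) := by ring

end HasJacobiParameters

end ThreeTermRecurrence

section MarkovFunctional

variable {R T : Type*} [CommSemiring R]

/-- A one-variable polynomial `f`, read as the polynomial `f (X t)` in the coordinate at time `t` of
a process. -/
noncomputable def atTime (t : T) : R[X] →ₐ[R] MvPolynomial T R :=
  Polynomial.aeval (MvPolynomial.X t)

@[simp]
theorem atTime_X (t : T) : atTime t (X : R[X]) = MvPolynomial.X t :=
  aeval_X _

theorem atTime_mem_supported {S : Set T} {t : T} (ht : t ∈ S) (f : R[X]) :
    atTime t f ∈ MvPolynomial.supported R S := by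
  refine aeval_mem_adjoin_singleton R (MvPolynomial.X t) |> Algebra.adjoin_mono ?_
  exact Set.singleton_subset_iff.2 (Set.mem_image_of_mem _ ht)

variable [LinearOrder T] {K : T → T → R[X] → R[X]} {E F : MvPolynomial T R →ₗ[R] R}

/-- The algebraic Markov property of the moment functional `E` of a process indexed by `T`: given
the past up to time `s`, the conditional expectation of `f (X t)` is `(K s t f) (X s)`. -/
def IsMarkovFunctional (K : T → T → R[X] → R[X]) (E : MvPolynomial T R →ₗ[R] R) : Prop :=
  ∀ ⦃s t⦄, s ≤ t → ∀ W ∈ MvPolynomial.supported R (Set.Iic s), ∀ f : R[X],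
    E (W * atTime t f) = E (W * atTime s (K s t f))

theorem exists_forall_isMarkovFunctional_map_mul_monomial (a : R) (k : T →₀ ℕ) :
    ∀ s, (∀ t ∈ k.support, s ≤ t) → ∃ g : R[X], ∀ E, IsMarkovFunctional K E →
      ∀ W ∈ MvPolynomial.supported R (Set.Iic s),
        E (W * MvPolynomial.monomial k a) = E (W * atTime s g) := by
  induction k using Finsupp.induction_on_min with
  | zero => exact fun s _ => ⟨C a, fun E _ W _ => by simp [atTime, MvPolynomial.algebraMap_eq]⟩
  | single_add u b k hu hb ih =>
    intro s hs
    have hsu : s ≤ u := hs u <| by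
      have : k u = 0 := Finsupp.notMem_support_iff.1 fun h => (hu u h).false
      simp [this, hb]
    obtain ⟨g, hg⟩ := ih u fun t ht => (hu t ht).le
    refine ⟨K s u (X ^ b * g), fun E hE W hW => ?_⟩
    have hWu : W * MvPolynomial.X u ^ b ∈ MvPolynomial.supported R (Set.Iic u) :=
      mul_mem (MvPolynomial.supported_mono (Set.Iic_subset_Iic.2 hsu) hW)
        (by simpa using atTime_mem_supported (R := R) (Set.self_mem_Iic (a := u)) (X ^ b))
    calc E (W * MvPolynomial.monomial (Finsupp.single u b + k) a)
        = E (W * MvPolynomial.X u ^ b * MvPolynomial.monomial k a) := by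
          rw [MvPolynomial.monomial_single_add, mul_assoc]
      _ = E (W * MvPolynomial.X u ^ b * atTime u g) := hg E hE _ hWu
      _ = E (W * atTime u (X ^ b * g)) := by
          rw [mul_assoc, ← atTime_X, ← map_pow, ← map_mul]
      _ = E (W * atTime s (K s u (X ^ b * g))) := hE hsu W hW _

/-- Since `g` is the same for all `E`, it is a conditional expectation given the present `s` of the
functional `V` of the future, computed from `K` alone. -/
theorem exists_forall_isMarkovFunctional_map_mul (K : T → T → R[X] → R[X]) {s : T}
    {V : MvPolynomial T R} (hV : V ∈ MvPolynomial.supported R (Set.Ici s)) :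
    ∃ g : R[X], ∀ E, IsMarkovFunctional K E → ∀ W ∈ MvPolynomial.supported R (Set.Iic s),
      E (W * V) = E (W * atTime s g) := by
  rw [MvPolynomial.mem_supported] at hV
  rw [V.as_sum]
  refine Finset.sum_induction _ (fun V => ∃ g : R[X], ∀ E, IsMarkovFunctional K E →
    ∀ W ∈ MvPolynomial.supported R (Set.Iic s), E (W * V) = E (W * atTime s g)) ?_ ?_ ?_
  · rintro V₁ V₂ ⟨g₁, h₁⟩ ⟨g₂, h₂⟩
    exact ⟨g₁ + g₂, fun E hE W hW => by
      rw [mul_add, map_add, map_add, mul_add, map_add, h₁ E hE W hW, h₂ E hE W hW]⟩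
  · exact ⟨0, fun E _ W _ => by rw [map_zero]⟩
  · exact fun k hk => exists_forall_isMarkovFunctional_map_mul_monomial _ k s fun t ht =>
      hV (MvPolynomial.support_subset_vars_of_mem_support hk ht)

namespace IsMarkovFunctional

theorem ext [Nonempty T] (hE : IsMarkovFunctional K E) (hF : IsMarkovFunctional K F)
    (h : ∀ t f, E (atTime t f) = F (atTime t f)) : E = F := by
  refine LinearMap.ext fun V => ?_
  obtain ⟨s, hs⟩ := V.vars.finite_toSet.bddBelow
  obtain ⟨g, hg⟩ := exists_forall_isMarkovFunctional_map_mul K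
    (MvPolynomial.mem_supported.2 fun t ht => hs ht : V ∈ MvPolynomial.supported R (Set.Ici s))
  have hEV := hg E hE 1 (one_mem _)
  have hFV := hg F hF 1 (one_mem _)
  rw [one_mul, one_mul] at hEV hFV
  rw [hEV, hFV, h]

theorem map_mul_atTime_of_duality (hE : IsMarkovFunctional K E) {s t : T} (hst : s ≤ t)
    {f g : R[X]} (hfg : ∀ q, E (atTime s (f * K s t q)) = E (atTime t (g * q)))
    {W : MvPolynomial T R} (hW : W ∈ MvPolynomial.supported R (Set.Ici t)) :
    E (W * atTime s f) = E (W * atTime t g) := by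
  obtain ⟨q, hq⟩ := exists_forall_isMarkovFunctional_map_mul K hW
  calc E (W * atTime s f) = E (atTime s f * atTime t q) := by
        rw [mul_comm, hq E hE _ (atTime_mem_supported (Set.mem_Iic.2 hst) f)]
    _ = E (atTime s (f * K s t q)) := by
        rw [hE hst _ (atTime_mem_supported Set.self_mem_Iic f), map_mul (atTime s)]
    _ = E (atTime t g * atTime t q) := by rw [hfg, map_mul (atTime t)]
    _ = E (W * atTime t g) := by
        rw [mul_comm W, hq E hE _ (atTime_mem_supported Set.self_mem_Iic g)]

end IsMarkovFunctional

end MarkovFunctional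

section BoundedFamily

variable {Ω Ω' ι : Type*}

theorem aeval_atTime_apply (X : ι → Ω → ℝ) (i : ι) (f : ℝ[X]) (ω : Ω) :
    MvPolynomial.aeval X (atTime i f) ω = f.eval (X i ω) := by
  rw [atTime, ← Polynomial.aeval_algHom_apply, MvPolynomial.aeval_X, Polynomial.aeval_fn_apply,
    Polynomial.coe_aeval_eq_eval]

theorem measurable_aeval {mΩ : MeasurableSpace Ω} {X : ι → Ω → ℝ} {S : Set ι}
    (hX : ∀ i ∈ S, Measurable (X i)) {W : MvPolynomial ι ℝ}
    (hW : W ∈ MvPolynomial.supported ℝ S) : Measurable (MvPolynomial.aeval X W) := by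
  rw [MvPolynomial.supported_eq_adjoin_X] at hW
  induction hW using Algebra.adjoin_induction with
  | mem _ h =>
    obtain ⟨i, hi, rfl⟩ := h
    simpa only [MvPolynomial.aeval_X] using hX i hi
  | algebraMap a => rw [AlgHom.commutes]; exact measurable_const
  | add p q _ _ hp hq => simpa only [map_add] using hp.add hq
  | mul p q _ _ hp hq => simpa only [map_mul] using hp.mul hq

/-- The linear form `L` on `ℝ ^ I`, as a polynomial in the variables `X i`, `i ∈ I`. -/
noncomputable def linearForm {I : Finset ι} (L : Module.Dual ℝ (I → ℝ)) : MvPolynomial ι ℝ :=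
  open Classical in ∑ i : I, L (Pi.single i 1) • MvPolynomial.X (i : ι)

theorem aeval_linearForm {I : Finset ι} (L : Module.Dual ℝ (I → ℝ)) (X : ι → Ω → ℝ) (ω : Ω) :
    MvPolynomial.aeval X (linearForm L) ω = L fun i => X i ω := by
  classical
  simp only [linearForm, map_sum, map_smul, MvPolynomial.aeval_X, Finset.sum_apply, Pi.smul_apply,
    smul_eq_mul]
  conv_rhs => rw [pi_eq_sum_univ' fun i : I => X i ω, map_sum]
  refine Finset.sum_congr rfl fun i _ => ?_
  rw [map_smul, smul_eq_mul, mul_comm]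

variable [MeasurableSpace Ω] [MeasurableSpace Ω'] {μ : Measure Ω} {ν : Measure Ω'}

theorem memLp_top_aeval {X : ι → Ω → ℝ} (hX : ∀ i, MemLp (X i) ∞ μ) (q : MvPolynomial ι ℝ) :
    MemLp (MvPolynomial.aeval X q) ∞ μ := by
  induction q using MvPolynomial.induction_on with
  | C a => rw [MvPolynomial.algHom_C]; exact memLp_top_const a
  | add p q hp hq => simpa only [map_add] using hp.add hq
  | mul_X p i hp => simpa only [map_mul, MvPolynomial.aeval_X] using (hX i).mul hp

variable [IsFiniteMeasure μ] [IsFiniteMeasure ν]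

/-- The expectation of polynomials in a family of bounded random variables. -/
noncomputable def momentFunctional {X : ι → Ω → ℝ} (hX : ∀ i, MemLp (X i) ∞ μ) :
    MvPolynomial ι ℝ →ₗ[ℝ] ℝ where
  toFun q := ∫ ω, MvPolynomial.aeval X q ω ∂μ
  map_add' p q := by
    simp only [map_add, Pi.add_apply]
    exact integral_add ((memLp_top_aeval hX p).integrable le_top)
      ((memLp_top_aeval hX q).integrable le_top)
  map_smul' a p := by
    simp only [map_smul, Pi.smul_apply, smul_eq_mul, integral_const_mul, RingHom.id_apply]

theorem momentFunctional_apply {X : ι → Ω → ℝ} (hX : ∀ i, MemLp (X i) ∞ μ)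
    (q : MvPolynomial ι ℝ) : momentFunctional hX q = ∫ ω, MvPolynomial.aeval X q ω ∂μ :=
  rfl

theorem hasSum_integral_cexp {Z : Ω → ℝ} (hZ : MemLp Z ∞ μ) :
    HasSum (fun n : ℕ => Complex.I ^ n / n.factorial * ((∫ ω, Z ω ^ n ∂μ : ℝ) : ℂ))
      (∫ ω, Complex.exp (Z ω * Complex.I) ∂μ) := by
  set c := lpNorm Z ∞ μ
  have hasSum_exp (ω : Ω) :
      HasSum (fun n : ℕ => Complex.I ^ n / n.factorial * ((Z ω ^ n : ℝ) : ℂ))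
        (Complex.exp (Z ω * Complex.I)) := by
    rw [Complex.exp_eq_exp_ℂ]
    simpa only [Complex.ofReal_pow, mul_pow, mul_comm, mul_div_right_comm]
      using NormedSpace.expSeries_div_hasSum_exp (Z ω * Complex.I : ℂ)
  have norm_term_le (n : ℕ) : ∀ᵐ ω ∂μ,
      ‖Complex.I ^ n / n.factorial * ((Z ω ^ n : ℝ) : ℂ)‖ ≤ c ^ n / n.factorial := by
    filter_upwards [ae_le_lpNorm_exponent_top hZ] with ω hω
    simp only [norm_mul, norm_div, norm_pow, Complex.norm_I, one_pow, Complex.norm_natCast,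
      Complex.norm_real]
    rw [one_div_mul_eq_div]
    gcongr
  simp only [← integral_complex_ofReal, ← integral_const_mul]
  refine hasSum_integral_of_dominated_convergence (fun n _ => c ^ n / n.factorial) (fun n => ?_)
    norm_term_le (.of_forall fun _ => Real.summable_pow_div_factorial c) (integrable_const _)
    (.of_forall hasSum_exp)
  exact (Complex.continuous_ofReal.comp_aestronglyMeasurable (hZ.1.pow n)).const_mul _

theorem integral_cexp_aeval_eq {X : ι → Ω → ℝ} {Y : ι → Ω' → ℝ} (hX : ∀ i, MemLp (X i) ∞ μ)
    (hY : ∀ i, MemLp (Y i) ∞ ν) (h : momentFunctional hX = momentFunctional hY)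
    (q : MvPolynomial ι ℝ) :
    ∫ ω, Complex.exp (MvPolynomial.aeval X q ω * Complex.I) ∂μ
      = ∫ ω, Complex.exp (MvPolynomial.aeval Y q ω * Complex.I) ∂ν := by
  have moment_eq (n : ℕ) :
      ∫ ω, MvPolynomial.aeval X q ω ^ n ∂μ = ∫ ω, MvPolynomial.aeval Y q ω ^ n ∂ν := by
    simpa only [momentFunctional_apply, map_pow, Pi.pow_apply] using LinearMap.congr_fun h (q ^ n)
  have hasSum_X := hasSum_integral_cexp (memLp_top_aeval hX q)
  simp only [moment_eq] at hasSum_X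
  exact hasSum_X.unique (hasSum_integral_cexp (memLp_top_aeval hY q))

theorem identDistrib_of_momentFunctional_eq {X : ι → Ω → ℝ} {Y : ι → Ω' → ℝ}
    (hX : ∀ i, MemLp (X i) ∞ μ) (hY : ∀ i, MemLp (Y i) ∞ ν)
    (h : momentFunctional hX = momentFunctional hY) (I : Finset ι) :
    IdentDistrib (fun ω (i : I) => X i ω) (fun ω (i : I) => Y i ω) μ ν := by
  have aemeasurable_X : AEMeasurable (fun ω (i : I) => X i ω) μ :=
    aemeasurable_pi_lambda _ fun i => (hX i).1.aemeasurable
  have aemeasurable_Y : AEMeasurable (fun ω (i : I) => Y i ω) ν :=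
    aemeasurable_pi_lambda _ fun i => (hY i).1.aemeasurable
  refine ⟨aemeasurable_X, aemeasurable_Y, Measure.ext_of_charFunDual (funext fun L => ?_)⟩
  have := integral_cexp_aeval_eq hX hY h (linearForm (L : Module.Dual ℝ (I → ℝ)))
  simp only [aeval_linearForm, ContinuousLinearMap.coe_coe] at this
  rwa [charFunDual_apply, charFunDual_apply, integral_map aemeasurable_X (by fun_prop),
    integral_map aemeasurable_Y (by fun_prop)]

end BoundedFamily

section MomentGrowth

variable {Ω : Type*} [MeasurableSpace Ω] {μ : Measure Ω} [IsFiniteMeasure μ]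

theorem measureReal_le_abs_le_of_integral_pow_le {Z : Ω → ℝ}
    (hint : ∀ n, Integrable (fun ω => Z ω ^ (2 * n)) μ) {C R r : ℝ} (hr : 0 < r)
    (h : ∀ n, ∫ ω, Z ω ^ (2 * n) ∂μ ≤ C * R ^ (2 * n)) (n : ℕ) :
    μ.real {ω | r ≤ |Z ω|} ≤ C * ((R / r) ^ 2) ^ n := by
  have markov_inequality := mul_meas_ge_le_integral_of_nonneg (μ := μ)
    (.of_forall fun ω => (even_two_mul n).pow_nonneg (Z ω)) (hint n) (r ^ (2 * n))
  have level_set_subset : {ω | r ≤ |Z ω|} ⊆ {ω | r ^ (2 * n) ≤ Z ω ^ (2 * n)} := fun ω hω => by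
    rw [Set.mem_ofPred_eq, ← (even_two_mul n).pow_abs (Z ω)]
    exact pow_le_pow_left₀ hr.le hω _
  rw [← pow_mul, div_pow, ← mul_div_assoc, le_div_iff₀ (by positivity), mul_comm]
  calc r ^ (2 * n) * μ.real {ω | r ≤ |Z ω|}
      ≤ r ^ (2 * n) * μ.real {ω | r ^ (2 * n) ≤ Z ω ^ (2 * n)} :=
        mul_le_mul_of_nonneg_left (measureReal_mono level_set_subset) (by positivity)
    _ ≤ C * R ^ (2 * n) := markov_inequality.trans (h n)

theorem measureReal_le_abs_eq_zero_of_integral_pow_le {Z : Ω → ℝ}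
    (hint : ∀ n, Integrable (fun ω => Z ω ^ (2 * n)) μ) {C R r : ℝ} (hr : |R| < r)
    (h : ∀ n, ∫ ω, Z ω ^ (2 * n) ∂μ ≤ C * R ^ (2 * n)) :
    μ.real {ω | r ≤ |Z ω|} = 0 := by
  have r_pos : 0 < r := (abs_nonneg R).trans_lt hr
  have ratio_lt_one : (R / r) ^ 2 < 1 := by
    rw [sq_lt_one_iff_abs_lt_one, abs_div, abs_of_pos r_pos]
    exact (div_lt_one r_pos).2 hr
  have := (tendsto_pow_atTop_nhds_zero_of_lt_one (sq_nonneg _) ratio_lt_one).const_mul C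
  rw [mul_zero] at this
  exact le_antisymm
    (ge_of_tendsto' this (measureReal_le_abs_le_of_integral_pow_le hint r_pos h))
    measureReal_nonneg

theorem memLp_top_of_integral_pow_le {Z : Ω → ℝ}
    (hZ : AEStronglyMeasurable Z μ) (hint : ∀ n, Integrable (fun ω => Z ω ^ (2 * n)) μ) {C R : ℝ}
    (h : ∀ n, ∫ ω, Z ω ^ (2 * n) ∂μ ≤ C * R ^ (2 * n)) : MemLp Z ∞ μ := by
  have := measureReal_le_abs_eq_zero_of_integral_pow_le hint (lt_add_one |R|) h
  rw [measureReal_eq_zero_iff] at this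
  refine memLp_top_of_bound hZ (|R| + 1) ?_
  filter_upwards [measure_eq_zero_iff_ae_notMem.1 this] with ω hω
  exact (not_le.1 hω).le

end MomentGrowth

section ConditionalLaw

variable {Ω : Type*} {m mΩ : MeasurableSpace Ω} {P : Measure Ω}

theorem condExp_comp_ae_eq_integral [IsFiniteMeasure P] {Y : Ω → ℝ} {ν : Ω → Measure ℝ}
    (hm : m ≤ mΩ) (hY : Measurable Y) (hν : ∀ᵐ ω ∂P, IsProbabilityMeasure (ν ω))
    (h : ∀ B, MeasurableSet B → P⟦Y ⁻¹' B | m⟧ =ᵐ[P] fun ω => (ν ω).real B)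
    {f : ℝ → ℝ} (hf : StronglyMeasurable f) (hfY : Integrable (fun ω => f (Y ω)) P) :
    P[fun ω => f (Y ω) | m] =ᵐ[P] fun ω => ∫ y, f y ∂ν ω := by
  have measurable_id : @Measurable Ω Ω mΩ m id := measurable_id'' hm
  let κ := @condDistrib _ _ _ _ _ _ mΩ m Y id P _
  have κ_eq_ν : ∀ᵐ ω ∂P, ∀ a b : ℚ, (κ ω).real (Set.Ioo a b) = (ν ω).real (Set.Ioo a b) := by
    refine ae_all_iff.2 fun a => ae_all_iff.2 fun b => ?_
    have κ_eq_condExp := condDistrib_ae_eq_condExp (μ := P) measurable_id hY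
      (measurableSet_Ioo (a := (a : ℝ)) (b := b))
    rw [MeasurableSpace.comap_id] at κ_eq_condExp
    exact κ_eq_condExp.trans (h _ measurableSet_Ioo)
  have condExp_eq := condExp_ae_eq_integral_condDistrib measurable_id hY.aemeasurable hf hfY
  rw [MeasurableSpace.comap_id] at condExp_eq
  filter_upwards [condExp_eq, κ_eq_ν, hν] with ω condExp_eq κ_eq_ν _
  rw [condExp_eq]
  exact congrArg (fun ρ => ∫ y, f y ∂ρ) <| Real.measure_ext_Ioo_rat (μ := κ ω) fun a b =>
    (measureReal_eq_measureReal_iff).1 (κ_eq_ν a b)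

theorem map_eq_of_condExp_ae_eq_const [IsProbabilityMeasure P] {Y : Ω → ℝ} {ν : Measure ℝ}
    [IsFiniteMeasure ν] (hm : m ≤ mΩ) (hY : Measurable Y)
    (h : ∀ B, MeasurableSet B → P⟦Y ⁻¹' B | m⟧ =ᵐ[P] fun _ => ν.real B) : P.map Y = ν := by
  refine Measure.ext fun B hB => (measureReal_eq_measureReal_iff).1 ?_
  calc (P.map Y).real B = P.real (Y ⁻¹' B) := map_measureReal_apply hY hB
    _ = ∫ ω, (P⟦Y ⁻¹' B | m⟧) ω ∂P := by
      rw [integral_condExp hm, integral_indicator_const _ (hY hB), smul_eq_mul, mul_one]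
    _ = ∫ _, ν.real B ∂P := integral_congr_ae (h B hB)
    _ = ν.real B := by simp

theorem integral_mul_eq_of_condExp_ae_eq [IsFiniteMeasure P] {V W Z : Ω → ℝ} (hm : m ≤ mΩ)
    (hV : Integrable V P) (h : P[V | m] =ᵐ[P] W) (hZ : Measurable[m] Z) (hZ_top : MemLp Z ∞ P) :
    ∫ ω, Z ω * V ω ∂P = ∫ ω, Z ω * W ω ∂P := by
  have pull_out : P[Z * V | m] =ᵐ[P] Z * P[V | m] :=
    condExp_mul_of_stronglyMeasurable_left hZ.stronglyMeasurable (hV.mul_of_top_right hZ_top) hV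
  calc ∫ ω, Z ω * V ω ∂P = ∫ ω, (P[Z * V | m]) ω ∂P := (integral_condExp hm).symm
    _ = ∫ ω, Z ω * W ω ∂P := integral_congr_ae (pull_out.trans (.mul .rfl h))

end ConditionalLaw

section MartingalePolynomial

variable {η θ s t x : ℝ}

/-- The diagonal Jacobi parameters of the orthogonality measure of `transPoly η θ s t x`. -/
def jacobiDiag (η θ s t x : ℝ) : ℕ → ℝ
  | 0 => x
  | 1 => (t - s) * η + θ
  | _ + 2 => t * η + θ

/-- The off-diagonal Jacobi parameters of the orthogonality measure of `transPoly η θ s t x`. -/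
def jacobiOffDiag (η θ s t x : ℝ) : ℕ → ℝ
  | 0 => 0
  | 1 => (t - s) * (1 + x * η)
  | _ + 2 => t * (1 + η * θ)

theorem transPoly_add_three (η θ s t x : ℝ) (n : ℕ) :
    transPoly η θ s t x (n + 3) = (X - C (t * η + θ)) * transPoly η θ s t x (n + 2)
      - C (t * (1 + η * θ)) * transPoly η θ s t x (n + 1) := by
  rw [transPoly]

theorem hasJacobiParameters_transPoly (η θ s t x : ℝ) :
    HasJacobiParameters (transPoly η θ s t x) (jacobiDiag η θ s t x)
      (jacobiOffDiag η θ s t x) where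
  zero := by rw [transPoly]
  X_mul
    | 0 => by simp [transPoly, jacobiDiag, jacobiOffDiag]
    | 1 => by simp only [transPoly, jacobiDiag, jacobiOffDiag, Nat.sub_self]; ring
    | n + 2 => by
      simp only [jacobiDiag, jacobiOffDiag, Nat.add_succ_sub_one]
      linear_combination -transPoly_add_three η θ s t x n

theorem exists_abs_jacobiDiag_le (η θ s t x : ℝ) : ∃ A, ∀ n, |jacobiDiag η θ s t x n| ≤ A :=
  ⟨max |x| (max |(t - s) * η + θ| |t * η + θ|), by
    rintro (_ | _ | _) <;> simp [jacobiDiag]⟩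

theorem exists_abs_jacobiOffDiag_le (η θ s t x : ℝ) :
    ∃ B, ∀ n, |jacobiOffDiag η θ s t x n| ≤ B :=
  ⟨max |(t - s) * (1 + x * η)| |t * (1 + η * θ)|, by
    rintro (_ | _ | n)
    · simpa only [jacobiOffDiag, abs_zero] using le_max_of_le_left (abs_nonneg _)
    · exact le_max_left _ _
    · exact le_max_right _ _⟩

/-- The orthogonal polynomials of the law of `X_t`, where `X_0 = 0`. They turn out to be martingale
polynomials of the bi-Poisson process. -/
noncomputable abbrev martingalePoly (η θ t : ℝ) : ℕ → ℝ[X] := transPoly η θ 0 t 0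

theorem hasJacobiParameters_martingalePoly (η θ t : ℝ) :
    HasJacobiParameters (martingalePoly η θ t) (jacobiDiag η θ 0 t 0) (jacobiOffDiag η θ 0 t 0) :=
  hasJacobiParameters_transPoly η θ 0 t 0

/-- The linear operator on polynomials for which `martingalePoly` is a family of martingale
polynomials; `(transOp η θ s t f) (x)` is the integral of `f` with respect to `P_{s,t}(x, dy)`. -/
noncomputable def transOp (η θ s t : ℝ) : ℝ[X] →ₗ[ℝ] ℝ[X] :=
  (hasJacobiParameters_martingalePoly η θ t).basis.constr ℝ (martingalePoly η θ s)

@[simp]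
theorem transOp_martingalePoly (η θ s t : ℝ) (n : ℕ) :
    transOp η θ s t (martingalePoly η θ t n) = martingalePoly η θ s n := by
  rw [transOp, ← (hasJacobiParameters_martingalePoly η θ t).basis_apply,
    Module.Basis.constr_basis]

@[simp]
theorem transOp_self (η θ t : ℝ) : transOp η θ t t = LinearMap.id :=
  (hasJacobiParameters_martingalePoly η θ t).basis.ext fun n => by simp

theorem martingalePoly_combination_eq_transPoly (η θ s t x : ℝ) : ∀ n,
    martingalePoly η θ t (n + 3) + C (s * η + θ - x) * martingalePoly η θ t (n + 2)
        + C (s * (1 + η * θ)) * martingalePoly η θ t (n + 1)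
      = transPoly η θ s t x (n + 3) + C θ * transPoly η θ s t x (n + 2)
  | 0 => by
    simp only [martingalePoly, transPoly, map_add, map_sub, map_mul, map_zero, map_one]
    ring
  | 1 => by
    simp only [martingalePoly, transPoly, map_add, map_sub, map_mul, map_zero, map_one]
    ring
  | n + 2 => by
    have ih := martingalePoly_combination_eq_transPoly η θ s t x n
    have ih_succ := martingalePoly_combination_eq_transPoly η θ s t x (n + 1)
    simp only [add_assoc, Nat.reduceAdd] at ih_succ ⊢
    linear_combination (X - C (t * η + θ)) * ih_succ - C (t * (1 + η * θ)) * ih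
      + transPoly_add_three η θ 0 t 0 (n + 2)
      + C (s * η + θ - x) * transPoly_add_three η θ 0 t 0 (n + 1)
      + C (s * (1 + η * θ)) * transPoly_add_three η θ 0 t 0 n
      - transPoly_add_three η θ s t x (n + 2) - C θ * transPoly_add_three η θ s t x (n + 1)

/-- This is the identity behind the martingale property: its right-hand side is orthogonal to the
constants for `P_{s,t}(x, dy)`. -/
theorem martingalePoly_sub_eval_combination_eq_transPoly (η θ s t x : ℝ) (n : ℕ) :
    (martingalePoly η θ t (n + 2) - C ((martingalePoly η θ s (n + 2)).eval x))
        + C (s * η + θ - x)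
          * (martingalePoly η θ t (n + 1) - C ((martingalePoly η θ s (n + 1)).eval x))
        + C (s * (1 + η * θ)) * (martingalePoly η θ t n - C ((martingalePoly η θ s n).eval x))
      = transPoly η θ s t x (n + 2) + C θ * transPoly η θ s t x (n + 1) := by
  rcases n with _ | n
  · simp only [martingalePoly, transPoly, eval_zero, eval_one, eval_add, eval_sub,
      eval_mul, eval_X, eval_C, map_add, map_sub, map_mul, map_zero, map_one]
    ring
  · have eval_add_three := congrArg (fun f => C (f.eval x))
      (transPoly_add_three η θ 0 s 0 n)
    simp only [eval_sub, eval_mul, eval_X, eval_C, C_sub, C_mul] at eval_add_three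
    have combination := martingalePoly_combination_eq_transPoly η θ s t x n
    simp only [C_sub, C_mul] at combination ⊢
    linear_combination combination - eval_add_three

theorem map_martingalePoly {L : ℝ[X] →ₗ[ℝ] ℝ} (hL_one : L 1 = 1)
    (hL : ∀ n, L (transPoly η θ s t x (n + 1)) = 0) (n : ℕ) :
    L (martingalePoly η θ t n) = (martingalePoly η θ s n).eval x := by
  have hL_C (c : ℝ) : L (C c) = c := by
    rw [← mul_one (C c), ← smul_eq_C_mul, map_smul, hL_one, smul_eq_mul, mul_one]
  suffices L (martingalePoly η θ t n - C ((martingalePoly η θ s n).eval x)) = 0 by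
    rwa [map_sub, hL_C, sub_eq_zero] at this
  induction n using Nat.twoStepInduction with
  | zero => simp [transPoly]
  | one => simpa [transPoly] using hL 0
  | more n ih ih_succ =>
    have h := congrArg L (martingalePoly_sub_eval_combination_eq_transPoly η θ s t x n)
    rw [map_add, map_add, map_add, ← smul_eq_C_mul, ← smul_eq_C_mul, ← smul_eq_C_mul, map_smul,
      map_smul, map_smul, ih, ih_succ, hL, hL] at h
    simpa using h

theorem map_eq_eval_transOp {L : ℝ[X] →ₗ[ℝ] ℝ} (hL_one : L 1 = 1)
    (hL : ∀ n, L (transPoly η θ s t x (n + 1)) = 0) (f : ℝ[X]) :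
    L f = (transOp η θ s t f).eval x := by
  suffices L = leval x ∘ₗ transOp η θ s t from LinearMap.congr_fun this f
  refine (hasJacobiParameters_martingalePoly η θ t).basis.ext fun n => ?_
  simpa using map_martingalePoly hL_one hL n

end MartingalePolynomial

section TimeInversion

variable {η θ s t : ℝ}

/-- The substitution `f (y) ↦ f (t y)`. -/
noncomputable def dilate (t : ℝ) : ℝ[X] →ₐ[ℝ] ℝ[X] :=
  Polynomial.aeval (C t * X)

theorem dilate_X (t : ℝ) : dilate t X = C t * X :=
  aeval_X _

theorem dilate_C (t c : ℝ) : dilate t (C c) = C c :=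
  aeval_C _ _

theorem dilate_martingalePoly (η θ : ℝ) (ht : t ≠ 0) (n : ℕ) :
    dilate t (martingalePoly η θ t n) = t ^ n • martingalePoly θ η t⁻¹ n := by
  have hinv : C t * C t⁻¹ = (1 : ℝ[X]) := by rw [← C_mul, mul_inv_cancel₀ ht, C_1]
  match n with
  | 0 => simp [transPoly]
  | 1 => simp [transPoly, dilate_X, smul_eq_C_mul]
  | 2 =>
    simp only [martingalePoly, transPoly, map_add, map_sub, map_mul, map_pow, map_zero, map_one,
      dilate_X, dilate_C, smul_eq_C_mul]
    linear_combination (X * C t * C θ + C t) * hinv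
  | n + 3 =>
    rw [martingalePoly, transPoly, map_sub, map_mul, map_mul, dilate_martingalePoly η θ ht (n + 1),
      dilate_martingalePoly η θ ht (n + 2), martingalePoly, transPoly]
    simp only [map_add, map_sub, map_mul, map_pow, map_one, dilate_X, dilate_C, smul_eq_C_mul]
    linear_combination C t ^ (n + 2) * (C θ * martingalePoly θ η t⁻¹ (n + 2)
      + (1 + C η * C θ) * martingalePoly θ η t⁻¹ (n + 1)) * hinv

theorem map_martingalePoly_mul_self {L : ℝ[X] →ₗ[ℝ] ℝ} (hL_one : L 1 = 1)
    (hL : Pairwise fun m n => L (martingalePoly η θ t m * martingalePoly η θ t n) = 0) (n : ℕ) :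
    L (martingalePoly η θ t n * martingalePoly η θ t n) = t ^ n * (1 + η * θ) ^ (n - 1) := by
  rw [(hasJacobiParameters_martingalePoly η θ t).map_mul_self hL, hL_one, mul_one]
  rcases n with _ | n
  · simp
  · rw [Finset.prod_range_succ']
    simp [jacobiOffDiag, mul_pow, pow_succ, mul_right_comm]

/-- The transition operators from `s` to `t` and, in inverted time with exchanged parameters, from
`t⁻¹` to `s⁻¹` are adjoint to each other. -/
theorem map_dilate_mul_transOp {L L' : ℝ[X] →ₗ[ℝ] ℝ} (ht : t ≠ 0) (hs : s ≠ 0)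
    (hL_one : L 1 = 1) (hL'_one : L' 1 = 1)
    (hL : Pairwise fun m n => L (martingalePoly θ η t⁻¹ m * martingalePoly θ η t⁻¹ n) = 0)
    (hL' : Pairwise fun m n => L' (martingalePoly θ η s⁻¹ m * martingalePoly θ η s⁻¹ n) = 0)
    (f h : ℝ[X]) :
    L (dilate t f * transOp θ η t⁻¹ s⁻¹ h) = L' (dilate s (transOp η θ s t f) * h) := by
  suffices ((LinearMap.mul ℝ ℝ[X]).compr₂ L).compl₁₂ (dilate t).toLinearMap (transOp θ η t⁻¹ s⁻¹)
      = ((LinearMap.mul ℝ ℝ[X]).compr₂ L').compl₁₂ ((dilate s).toLinearMap ∘ₗ transOp η θ s t)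
        LinearMap.id from LinearMap.congr_fun₂ this f h
  refine LinearMap.ext_basis (hasJacobiParameters_martingalePoly η θ t).basis
    (hasJacobiParameters_martingalePoly θ η s⁻¹).basis fun m n => ?_
  simp only [HasJacobiParameters.basis_apply, LinearMap.compl₁₂_apply, LinearMap.compr₂_apply,
    LinearMap.mul_apply', AlgHom.toLinearMap_apply, LinearMap.comp_apply, LinearMap.id_apply,
    transOp_martingalePoly, dilate_martingalePoly η θ ht, dilate_martingalePoly η θ hs,
    map_smul, LinearMap.smul_apply, smul_eq_mul]
  rcases eq_or_ne m n with rfl | hmn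
  · rw [map_martingalePoly_mul_self hL_one hL, map_martingalePoly_mul_self hL'_one hL',
      ← mul_assoc, ← mul_assoc, ← mul_pow, ← mul_pow, mul_inv_cancel₀ ht, mul_inv_cancel₀ hs]
  · rw [hL hmn, hL' hmn, mul_zero, mul_zero]

end TimeInversion

section BiPoissonFunctional

/-- The index set `(0, ∞)` of time inversion. -/
abbrev PosTime : Type := Set.Ioi (0 : ℝ≥0)

/-- The map `t ↦ 1 / t` of `(0, ∞)` to itself. -/
noncomputable def invTime (t : PosTime) : PosTime :=
  ⟨1 / t, Set.mem_Ioi.2 (one_div_pos.2 t.2)⟩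

theorem coe_invTime (t : PosTime) : (invTime t : ℝ) = (t : ℝ)⁻¹ := by
  simp [invTime]

theorem invTime_antitone : Antitone invTime := fun s _ hst =>
  one_div_le_one_div_of_le (Set.mem_Ioi.1 s.2) hst

theorem PosTime.coe_ne_zero (t : PosTime) : (t : ℝ) ≠ 0 :=
  NNReal.coe_ne_zero.2 (Set.mem_Ioi.1 t.2).ne'

/-- On moment functionals, composition with this substitution `X_t ↦ t X_{1/t}` is time
inversion. -/
noncomputable def timeInversion : MvPolynomial PosTime ℝ →ₐ[ℝ] MvPolynomial PosTime ℝ :=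
  MvPolynomial.aeval fun t => (t : ℝ) • MvPolynomial.X (invTime t)

theorem timeInversion_atTime (t : PosTime) (f : ℝ[X]) :
    timeInversion (atTime t f) = atTime (invTime t) (dilate t f) := by
  suffices timeInversion.comp (atTime t) = (atTime (invTime t)).comp (dilate (t : ℝ)) from
    DFunLike.congr_fun this f
  refine Polynomial.algHom_ext ?_
  simp only [AlgHom.comp_apply, atTime_X, dilate_X, timeInversion, MvPolynomial.aeval_X,
    ← smul_eq_C_mul, map_smul]

theorem timeInversion_mem_supported {s : PosTime} {W : MvPolynomial PosTime ℝ}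
    (hW : W ∈ MvPolynomial.supported ℝ (Set.Iic s)) :
    timeInversion W ∈ MvPolynomial.supported ℝ (Set.Ici (invTime s)) := by
  suffices MvPolynomial.supported ℝ (Set.Iic s)
      ≤ (MvPolynomial.supported ℝ (Set.Ici (invTime s))).comap timeInversion from this hW
  rw [MvPolynomial.supported_eq_adjoin_X, Algebra.adjoin_le_iff]
  rintro _ ⟨t, ht, rfl⟩
  rw [SetLike.mem_coe, Subalgebra.mem_comap, timeInversion, MvPolynomial.aeval_X]
  refine Subalgebra.smul_mem _ ?_ _
  exact MvPolynomial.X_mem_supported.2 (invTime_antitone ht)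

variable {η θ : ℝ} {E F : MvPolynomial PosTime ℝ →ₗ[ℝ] ℝ}

/-- `E` behaves like the moment functional `f ↦ 𝔼[f (X)]` of a bi-Poisson process with parameters
`η` and `θ`, restricted to positive times. -/
structure IsBiPoissonFunctional (η θ : ℝ) (E : MvPolynomial PosTime ℝ →ₗ[ℝ] ℝ) : Prop where
  map_one : E 1 = 1
  orthogonal : ∀ t : PosTime, Pairwise fun m n =>
    E (atTime t (martingalePoly η θ t m * martingalePoly η θ t n)) = 0
  markov : IsMarkovFunctional (fun s t : PosTime => transOp η θ s t) E

namespace IsBiPoissonFunctional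

theorem map_atTime_martingalePoly_succ (hE : IsBiPoissonFunctional η θ E) (t : PosTime) (n : ℕ) :
    E (atTime t (martingalePoly η θ t (n + 1))) = 0 := by
  simpa only [(hasJacobiParameters_martingalePoly η θ t).zero, mul_one]
    using hE.orthogonal t n.succ_ne_zero

theorem unique (hE : IsBiPoissonFunctional η θ E) (hF : IsBiPoissonFunctional η θ F) : E = F := by
  have : Nonempty PosTime := ⟨1, Set.mem_Ioi.2 one_pos⟩
  refine hE.markov.ext hF.markov fun t f => ?_
  suffices E ∘ₗ (atTime t).toLinearMap = F ∘ₗ (atTime t).toLinearMap from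
    LinearMap.congr_fun this f
  refine (hasJacobiParameters_martingalePoly η θ t).basis.ext fun n => ?_
  rcases n with _ | n
  · simp [(hasJacobiParameters_martingalePoly η θ t).zero, hE.map_one, hF.map_one]
  · simp [hE.map_atTime_martingalePoly_succ, hF.map_atTime_martingalePoly_succ]

theorem orthogonal_invTime (hE : IsBiPoissonFunctional θ η E) (t : PosTime) :
    Pairwise fun m n => E (atTime (invTime t)
      (martingalePoly θ η (t : ℝ)⁻¹ m * martingalePoly θ η (t : ℝ)⁻¹ n)) = 0 := by
  simpa only [coe_invTime] using hE.orthogonal (invTime t)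

theorem comp_timeInversion (hE : IsBiPoissonFunctional θ η E) :
    IsBiPoissonFunctional η θ (E ∘ₗ timeInversion.toLinearMap) where
  map_one := by simpa using hE.map_one
  orthogonal t m n hmn := by
    beta_reduce
    rw [LinearMap.comp_apply, AlgHom.toLinearMap_apply, timeInversion_atTime,
      map_mul, dilate_martingalePoly η θ t.coe_ne_zero, dilate_martingalePoly η θ t.coe_ne_zero,
      smul_mul_smul_comm, map_smul, map_smul, hE.orthogonal_invTime t hmn, smul_zero]
  markov s t hst W hW f := by
    simp only [LinearMap.comp_apply, AlgHom.toLinearMap_apply, map_mul, timeInversion_atTime]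
    refine hE.markov.map_mul_atTime_of_duality (invTime_antitone hst) (fun q => ?_)
      (timeInversion_mem_supported hW)
    simp only [coe_invTime]
    exact map_dilate_mul_transOp (L := E ∘ₗ (atTime (invTime t)).toLinearMap)
      (L' := E ∘ₗ (atTime (invTime s)).toLinearMap) t.coe_ne_zero s.coe_ne_zero
      (by simpa using hE.map_one) (by simpa using hE.map_one)
      (hE.orthogonal_invTime t) (hE.orthogonal_invTime s) f q

end IsBiPoissonFunctional

end BiPoissonFunctional

section OrthogonalityMeasure

variable {η θ : ℝ} {μ : Measure ℝ}

theorem integrable_eval (h : ∀ n : ℕ, Integrable (fun y : ℝ => y ^ n) μ) (f : ℝ[X]) :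
    Integrable (fun y => f.eval y) μ := by
  induction f using Polynomial.induction_on' with
  | add f g hf hg => simp only [eval_add]; exact hf.add hg
  | monomial n a => simpa only [eval_monomial] using (h n).const_mul a

/-- Integration of polynomials against a measure with finite moments. -/
noncomputable def polynomialIntegral (μ : Measure ℝ)
    (h : ∀ n : ℕ, Integrable (fun y : ℝ => y ^ n) μ) : ℝ[X] →ₗ[ℝ] ℝ where
  toFun f := ∫ y, f.eval y ∂μ
  map_add' f g := by
    simp only [eval_add]
    exact integral_add (integrable_eval h f) (integrable_eval h g)
  map_smul' a f := by simp only [eval_smul, smul_eq_mul, integral_const_mul, RingHom.id_apply]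

theorem polynomialIntegral_apply (h : ∀ n : ℕ, Integrable (fun y : ℝ => y ^ n) μ) (f : ℝ[X]) :
    polynomialIntegral μ h f = ∫ y, f.eval y ∂μ :=
  rfl

theorem isOrthogonalityMeasure_transition {s t : ℝ≥0} {x : ℝ} (h : transition η θ s t x ≠ 0) :
    IsOrthogonalityMeasure (transPoly η θ s t x) (transition η θ s t x) := by
  unfold transition at h ⊢
  split_ifs at h ⊢ with hex
  · exact hex.choose_spec
  · exact absurd rfl h

namespace IsOrthogonalityMeasure

variable {s t x : ℝ}

theorem polynomialIntegral_one {Q : ℕ → ℝ[X]} (hμ : IsOrthogonalityMeasure Q μ) :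
    polynomialIntegral μ hμ.2.1 1 = 1 := by
  have := hμ.1
  simp [polynomialIntegral_apply]

theorem polynomialIntegral_transPoly_succ (hμ : IsOrthogonalityMeasure (transPoly η θ s t x) μ)
    (n : ℕ) : polynomialIntegral μ hμ.2.1 (transPoly η θ s t x (n + 1)) = 0 := by
  simpa [polynomialIntegral_apply, (hasJacobiParameters_transPoly η θ s t x).zero]
    using hμ.2.2 (n + 1) 0 n.succ_ne_zero

theorem integral_eval (hμ : IsOrthogonalityMeasure (transPoly η θ s t x) μ) (f : ℝ[X]) :
    ∫ y, f.eval y ∂μ = (transOp η θ s t f).eval x :=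
  map_eq_eval_transOp hμ.polynomialIntegral_one hμ.polynomialIntegral_transPoly_succ f

theorem memLp_top_id (hμ : IsOrthogonalityMeasure (transPoly η θ s t x) μ) : MemLp id ∞ μ := by
  have := hμ.1
  obtain ⟨A, hA⟩ := exists_abs_jacobiDiag_le η θ s t x
  obtain ⟨B, hB⟩ := exists_abs_jacobiOffDiag_le η θ s t x
  refine memLp_top_of_integral_pow_le aestronglyMeasurable_id (fun n => hμ.2.1 (2 * n))
    (C := 1) (R := 1 + A + B) fun n => ?_
  have moment_le := (hasJacobiParameters_transPoly η θ s t x).abs_map_X_pow_mul_le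
    hμ.polynomialIntegral_transPoly_succ hA hB (2 * n) 0
  rw [(hasJacobiParameters_transPoly η θ s t x).zero, mul_one, hμ.polynomialIntegral_one, abs_one,
    polynomialIntegral_apply] at moment_le
  simpa only [eval_pow, eval_X, id_eq] using (le_abs_self _).trans moment_le

end IsOrthogonalityMeasure

end OrthogonalityMeasure

namespace IsBiPoissonProcess

variable {Ω : Type*} {X : ℝ≥0 → Ω → ℝ}

theorem measurable_past {r s : ℝ≥0} (h : r ≤ s) :
    Measurable[past X s] (X r) := by
  rw [measurable_iff_comap_le, BorelSpace.measurable_eq (α := ℝ)]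
  exact le_iSup₂_of_le r h le_rfl

variable [mΩ : MeasurableSpace Ω] {P : Measure Ω} {η θ : ℝ}

theorem past_le (hX : IsBiPoissonProcess η θ X P) (s : ℝ≥0) : past X s ≤ mΩ := by
  refine iSup₂_le fun r _ => ?_
  rw [← BorelSpace.measurable_eq (α := ℝ)]
  exact (hX.measurable r).comap_le

variable [IsProbabilityMeasure P]

theorem ae_isOrthogonalityMeasure_transition (hX : IsBiPoissonProcess η θ X P) {s t : ℝ≥0}
    (hst : s < t) : ∀ᵐ ω ∂P,
      IsOrthogonalityMeasure (transPoly η θ s t (X s ω)) (transition η θ s t (X s ω)) := by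
  have total_mass := hX.markov s t hst Set.univ .univ
  simp only [Set.preimage_univ, Set.indicator_univ] at total_mass
  rw [condExp_const (hX.past_le s)] at total_mass
  filter_upwards [total_mass] with ω hω
  refine isOrthogonalityMeasure_transition fun transition_eq_zero => ?_
  simp [transition_eq_zero] at hω

theorem isOrthogonalityMeasure_map (hX : IsBiPoissonProcess η θ X P) {t : ℝ≥0} (ht : 0 < t) :
    IsOrthogonalityMeasure (martingalePoly η θ t) (P.map (X t)) := by
  obtain ⟨ω, hω, orthogonal⟩ :=
    (hX.initial.and (hX.ae_isOrthogonalityMeasure_transition ht)).exists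
  rw [hω, NNReal.coe_zero] at orthogonal
  have := orthogonal.1
  have law_eq : P.map (X t) = transition η θ 0 t 0 := by
    refine map_eq_of_condExp_ae_eq_const (hX.past_le 0) (hX.measurable t) fun B hB => ?_
    filter_upwards [hX.markov 0 t ht B hB, hX.initial] with ω markov initial
    rw [markov, initial]
  rwa [law_eq]

theorem memLp_top (hX : IsBiPoissonProcess η θ X P) {t : ℝ≥0} (ht : 0 < t) : MemLp (X t) ∞ P :=
  (memLp_map_measure_iff aestronglyMeasurable_id (hX.measurable t).aemeasurable).1
    (hX.isOrthogonalityMeasure_map ht).memLp_top_id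

theorem integrable_eval (hX : IsBiPoissonProcess η θ X P) {t : ℝ≥0} (ht : 0 < t) (f : ℝ[X]) :
    Integrable (fun ω => f.eval (X t ω)) P :=
  (BiPoisson.integrable_eval (hX.isOrthogonalityMeasure_map ht).2.1 f).comp_measurable
    (hX.measurable t)

theorem condExp_eval (hX : IsBiPoissonProcess η θ X P) {s t : ℝ≥0} (hst : s < t) (f : ℝ[X]) :
    P[fun ω => f.eval (X t ω) | past X s] =ᵐ[P] fun ω => (transOp η θ s t f).eval (X s ω) := by
  have orthogonal := hX.ae_isOrthogonalityMeasure_transition hst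
  have condExp_eq := condExp_comp_ae_eq_integral (hX.past_le s) (hX.measurable t)
    (orthogonal.mono fun _ h => h.1) (hX.markov s t hst) f.continuous.stronglyMeasurable
    (hX.integrable_eval (zero_le.trans_lt hst) f)
  filter_upwards [condExp_eq, orthogonal] with ω condExp_eq orthogonal
  rw [condExp_eq, orthogonal.integral_eval]

/-- The moments of the process at positive times. -/
noncomputable def moments (hX : IsBiPoissonProcess η θ X P) : MvPolynomial PosTime ℝ →ₗ[ℝ] ℝ :=
  momentFunctional fun t : PosTime => hX.memLp_top t.2

theorem moments_atTime (hX : IsBiPoissonProcess η θ X P) (t : PosTime) (f : ℝ[X]) :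
    hX.moments (atTime t f) = ∫ y, f.eval y ∂(P.map (X t)) := by
  rw [integral_map (hX.measurable t).aemeasurable f.continuous.aestronglyMeasurable]
  simp only [moments, momentFunctional_apply, aeval_atTime_apply]

theorem isMarkovFunctional_moments (hX : IsBiPoissonProcess η θ X P) :
    IsMarkovFunctional (fun s t : PosTime => transOp η θ s t) hX.moments := by
  intro s t hst W hW f
  rcases hst.eq_or_lt with rfl | hst
  · simp only [transOp_self, LinearMap.id_apply]
  · have measurable_W : Measurable[past X s] (MvPolynomial.aeval (fun t : PosTime => X t) W) :=
      measurable_aeval (fun _ hr => measurable_past hr) hW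
    simp only [moments, momentFunctional_apply, map_mul, Pi.mul_apply, aeval_atTime_apply]
    exact integral_mul_eq_of_condExp_ae_eq (hX.past_le s) (hX.integrable_eval t.2 f)
      (hX.condExp_eval hst f) measurable_W (memLp_top_aeval (fun t => hX.memLp_top t.2) W)

theorem isBiPoissonFunctional_moments (hX : IsBiPoissonProcess η θ X P) :
    IsBiPoissonFunctional η θ hX.moments where
  map_one := by simp [moments, momentFunctional_apply]
  orthogonal t m n hmn := by
    simpa only [moments_atTime, eval_mul] using (hX.isOrthogonalityMeasure_map t.2).2.2 m n hmn
  markov := hX.isMarkovFunctional_moments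

theorem memLp_top_mul_invTime (hX : IsBiPoissonProcess η θ X P) (t : PosTime) :
    MemLp (fun ω => (t : ℝ) * X (invTime t) ω) ∞ P :=
  (hX.memLp_top (invTime t).2).const_mul t

theorem momentFunctional_mul_invTime (hX : IsBiPoissonProcess η θ X P) :
    momentFunctional hX.memLp_top_mul_invTime = hX.moments ∘ₗ timeInversion.toLinearMap := by
  suffices MvPolynomial.aeval (fun (t : PosTime) ω => (t : ℝ) * X (invTime t) ω)
      = (MvPolynomial.aeval fun t : PosTime => X t).comp timeInversion from
    LinearMap.ext fun q =>
      congrArg (fun φ : MvPolynomial PosTime ℝ →ₐ[ℝ] Ω → ℝ => ∫ ω, φ q ω ∂P) this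
  refine MvPolynomial.algHom_ext fun t => ?_
  simp only [AlgHom.comp_apply, timeInversion, MvPolynomial.aeval_X, map_smul]
  rfl

end IsBiPoissonProcess

end BiPoisson

theorem mainTheorem3_general {Ω Ω' : Type*} [MeasurableSpace Ω] [MeasurableSpace Ω']
    (P : Measure Ω) [IsProbabilityMeasure P] (P' : Measure Ω') [IsProbabilityMeasure P']
    (η θ : ℝ) (X : ℝ≥0 → Ω → ℝ) (hX : BiPoisson.IsBiPoissonProcess η θ X P)
    (Y : ℝ≥0 → Ω' → ℝ) (hY : BiPoisson.IsBiPoissonProcess θ η Y P') :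
    ∀ I : Finset (Set.Ioi (0 : ℝ≥0)),
      IdentDistrib (fun ω (t : I) => ((t : Set.Ioi (0 : ℝ≥0)) : ℝ) * Y (1 / t) ω)
        (fun ω (t : I) => X t ω) P' P := by
  refine BiPoisson.identDistrib_of_momentFunctional_eq hY.memLp_top_mul_invTime
    (fun t => hX.memLp_top t.2) ?_
  rw [hY.momentFunctional_mul_invTime]
  exact hY.isBiPoissonFunctional_moments.comp_timeInversion.unique hX.isBiPoissonFunctional_moments

theorem mainTheorem3 {Ω : Type*} [MeasurableSpace Ω] (P : Measure Ω) [IsProbabilityMeasure P]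
    (η θ : ℝ) (hηθ : η = θ) (X : ℝ≥0 → Ω → ℝ)
    (hX : BiPoisson.IsBiPoissonProcess η θ X P) :
    ∀ I : Finset (Set.Ioi (0 : ℝ≥0)),
      IdentDistrib (fun ω (t : I) => ((t : Set.Ioi (0 : ℝ≥0)) : ℝ) * X (1 / t) ω)
        (fun ω (t : I) => X t ω) P P := by
  subst hηθ
  exact mainTheorem3_general P P η η X hX X hX
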